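/- Let $\mathcal{A}$ be a finite set of attributes, each attribute $i$ with a finite domain $\mathrm{Dom}(i)$, and let $D$ be a database over $\mathcal{A}$, i.e. a finite bag of tuples $t\in\prod_{i}\mathrm{Dom}(i)$. Let $G_D$ be the undirected graph on $\mathcal{A}$ in which two distinct attributes are adjacent iff their mutual information in $D$ is nonzero. A Marginals-MST of $D$ is a spanning tree of $G_D$; a directed Marginals-MST is obtained from one by giving each of its edges one direction (arbitrarily). Let $P,A,O\subseteq\mathcal{A}$ be pairwise disjoint sets of protected, admissible and outcome attributes, and let $T$ be a directed Marginals-MST of $D$. Suppose that every directed path in $T$ from an attribute in $P$ to an attribute in $O$ contains an attribute in $A$. Then the distribution of $T$ is justifiably fair, in the following sense. Let arbitrary conditional probability tables $\Pr[X_i\mid X_{\Pi_i}]$ be given on $T$, where $\Pi_i$ is the set of parents of $i$ in $T$, so that the distribution is $\Pr[x]=\prod_{i\in\mathcal{A}}\Pr[x_i\mid x_{\Pi_i}]$. For $S\subseteq\mathcal{A}$ let $\mathrm{do}(S=v)$ be the intervention that removes all edges into attributes of $S$ and sets these attributes to $v$, leaving the conditional probability tables of all the other attributes unchanged. Then for every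 $K\supseteq A$, every assignment $k$ to $K$, every joint assignment $o$ to $O$, every $i\in P\setminus K$ and all $p,q\in\mathrm{Dom}(i)$, $$\Pr[O=o\mid \mathrm{do}(i=p),\mathrm{do}(K=k)]=\Pr[O=o\mid \mathrm{do}(i=q),\mathrm{do}(K=k)].$$ -/

import Mathlib

open scoped ENNReal

noncomputable section

namespace FairMST

/-! ## Databases, mutual information and Marginals-MSTs

The attributes are indexed by a finite type `ι`, and attribute `i` has the finite domain `Dom i`.
A database is a bag (multiset) of tuples `t : ∀ i, Dom i`. -/

section Database

variable {ι : Type*} {Dom : ι → Type*}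

/-- One-way marginal: the fraction of the tuples of `D` whose attribute `i` has the value `a`. -/
def marginal1 [∀ i, DecidableEq (Dom i)] (D : Multiset (∀ i, Dom i)) (i : ι) (a : Dom i) : ℝ :=
  (D.countP (fun t => t i = a) : ℝ) / (D.card : ℝ)

/-- Two-way marginal: the fraction of the tuples of `D` whose attributes `i`, `j` have the
values `a`, `b`. -/
def marginal2 [∀ i, DecidableEq (Dom i)] (D : Multiset (∀ i, Dom i)) (i j : ι)
    (a : Dom i) (b : Dom j) : ℝ :=
  (D.countP (fun t => t i = a ∧ t j = b) : ℝ) / (D.card : ℝ)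

/-- Mutual information of the attributes `i` and `j` in the database `D`. The terms with
`P[i = a, j = b] = 0` vanish, which is the usual convention `0 log 0 = 0`. -/
def mutualInfo [∀ i, Fintype (Dom i)] [∀ i, DecidableEq (Dom i)]
    (D : Multiset (∀ i, Dom i)) (i j : ι) : ℝ :=
  ∑ a : Dom i, ∑ b : Dom j,
    marginal2 D i j a b *
      Real.log (marginal2 D i j a b / (marginal1 D i a * marginal1 D j b))

/-- The graph on the attributes in which two distinct attributes are adjacent unless their mutual
information is zero. -/
def mutualInfoGraph [∀ i, Fintype (Dom i)] [∀ i, DecidableEq (Dom i)]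
    (D : Multiset (∀ i, Dom i)) : SimpleGraph ι :=
  SimpleGraph.fromRel (fun i j => mutualInfo D i j ≠ 0)

/-- A Marginals-MST of `D`: a spanning tree of the mutual information graph of `D`. -/
def IsMarginalsMST [∀ i, Fintype (Dom i)] [∀ i, DecidableEq (Dom i)]
    (D : Multiset (∀ i, Dom i)) (T : SimpleGraph ι) : Prop :=
  T ≤ mutualInfoGraph D ∧ T.IsTree

/-- `G` arises from the undirected graph `T` by giving each edge exactly one direction. -/
def IsOrientationOf (G : Digraph ι) (T : SimpleGraph ι) : Prop :=
  (∀ i j, T.Adj i j ↔ G.Adj i j ∨ G.Adj j i) ∧ ∀ i j, G.Adj i j → ¬ G.Adj j i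

/-- A directed Marginals-MST of `D`: a Marginals-MST of `D` with a direction on every edge. -/
def IsDirectedMarginalsMST [∀ i, Fintype (Dom i)] [∀ i, DecidableEq (Dom i)]
    (D : Multiset (∀ i, Dom i)) (G : Digraph ι) : Prop :=
  ∃ T : SimpleGraph ι, IsMarginalsMST D T ∧ IsOrientationOf G T

end Database

/-! ## Directed paths -/

/-- The list `l` of vertices is a directed path of `G` from `s` to `t`. -/
def IsDirectedPath {ι : Type*} (G : Digraph ι) (s t : ι) (l : List ι) : Prop :=
  l.IsChain G.Adj ∧ l.Nodup ∧ l.head? = some s ∧ l.getLast? = some t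

/-! ## Bayes nets and interventions -/

/-- A Bayes net on the directed graph `G`: for each attribute `i`, a conditional probability table,
that is, a probability distribution on `Dom i` for each assignment of values to the parents of
`i` in `G`. -/
structure BayesNet {ι : Type*} (Dom : ι → Type*) (G : Digraph ι) where
  /-- The conditional distribution of an attribute given the values of its parents. -/
  cpt : ∀ i : ι, (∀ j : {j : ι // G.Adj j i}, Dom j) → PMF (Dom i)

/-- Remove all the edges that point to an attribute in `S`. -/
def cutIncoming {ι : Type*} (G : Digraph ι) (S : Finset ι) : Digraph ι where
  Adj j i := G.Adj j i ∧ i ∉ S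

namespace BayesNet

variable {ι : Type*} {Dom : ι → Type*} {G : Digraph ι}

/-- The distribution of the Bayes net (as a probability mass function on tuples):
the product over all attributes of the conditional probability given the parents. -/
def joint [Fintype ι] (N : BayesNet Dom G) (x : ∀ i, Dom i) : ℝ≥0∞ :=
  ∏ i, N.cpt i (fun j => x j) (x i)

/-- The probability `P[O = o]` that all the attributes in `O` take the values given by `o`
(only the coordinates of `o` in `O` matter). -/
def prob [Fintype ι] [DecidableEq ι] [∀ i, Fintype (Dom i)] [∀ i, DecidableEq (Dom i)]
    (N : BayesNet Dom G) (O : Finset ι) (o : ∀ i, Dom i) : ℝ≥0∞ :=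
  ∑ x : ∀ i, Dom i, if ∀ j ∈ O, x j = o j then N.joint x else 0

/-- The intervention `do(S = v)` (only the coordinates of `v` in `S` matter): the edges into the
attributes in `S` are removed, and these attributes are set to their values under `v`; the other
attributes keep their conditional probability tables. -/
def intervene [DecidableEq ι] (N : BayesNet Dom G) (S : Finset ι) (v : ∀ i, Dom i) :
    BayesNet Dom (cutIncoming G S) where
  cpt i u := if h : i ∈ S then PMF.pure (v i) else N.cpt i (fun j => u ⟨j.1, j.2, h⟩)

/-- `K`-fairness with respect to the protected attributes `P` and the outcome attributes `O`:
`P[O = o | do(i = p), do(K = k)] = P[O = o | do(i = q), do(K = k)]` for each context `k`, each joint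
outcome `o`, each protected attribute `i` (not itself fixed by `K`) and all values `p`, `q` of `i`. -/
def IsKFair [Fintype ι] [DecidableEq ι] [∀ i, Fintype (Dom i)] [∀ i, DecidableEq (Dom i)]
    (N : BayesNet Dom G) (P O K : Finset ι) : Prop :=
  ∀ k o : ∀ j, Dom j, ∀ i ∈ P, i ∉ K → ∀ p q : Dom i,
    (N.intervene (insert i K) (Function.update k i p)).prob O o =
      (N.intervene (insert i K) (Function.update k i q)).prob O o

/-- Justifiable fairness: `K`-fairness for all supersets `K` of the admissible attributes `A`. -/
def IsJustifiablyFair [Fintype ι] [DecidableEq ι] [∀ i, Fintype (Dom i)]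
    [∀ i, DecidableEq (Dom i)] (N : BayesNet Dom G) (P A O : Finset ι) : Prop :=
  ∀ K : Finset ι, A ⊆ K → N.IsKFair P O K

end BayesNet

end FairMST

end

/-!
Fix the context `K ⊇ A` and the protected attribute `i`, and let `H` be `T` with the edges into
`insert i K` removed. The two interventions `do(i = p), do(K = k)` and `do(i = q), do(K = k)` are
Bayes nets on `H` with the same tables except at `i`. Let `R` be the set of descendants of `i` in
`H`, with `i` itself.

* `R` contains no outcome attribute. A directed walk in `H` from `i` shortens to a directed path,
  and all its vertices after `i` have an incoming edge in `H`, so they are outside `K ⊇ A`. A path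
  to `O` would therefore contradict the hypothesis on `T`
  (`exists_isPath_of_reflTransGen`, `isDirectedPath_support`).
* `R` is closed under children, so its attributes can be summed out of the joint distribution
  (`sum_mul_joint_eq`): the probability of an event about attributes outside `R` depends only
  on the tables outside `R`, and there the two nets agree.

Summing out needs `H` to be acyclic. This is where the tree matters: a directed cycle through an
edge `u → v` contains a directed path from `v` back to `u`, which in a tree has to be the edge
`v → u`, while an orientation gives each edge only one direction (`wellFounded_of_isAcyclic`).
-/

namespace FairMST

/-! ### Directed walks in undirected graphs -/

section Graph

variable {ι : Type*}

theorem exists_isPath_of_reflTransGen {T : SimpleGraph ι} {r : ι → ι → Prop}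
    (hr : ∀ u v, r u v → T.Adj u v) {u v : ι} (h : Relation.ReflTransGen r u v) :
    ∃ p : T.Walk u v, p.IsPath ∧ ∀ d ∈ p.darts, r d.fst d.snd := by
  classical
  obtain ⟨p, hp⟩ : ∃ p : T.Walk u v, ∀ d ∈ p.darts, r d.fst d.snd := by
    induction h using Relation.ReflTransGen.head_induction_on with
    | refl => exact ⟨.nil, by simp⟩
    | head hab _ ih =>
      obtain ⟨p, hp⟩ := ih
      refine ⟨.cons (hr _ _ hab) p, fun d hd => ?_⟩
      rw [SimpleGraph.Walk.darts_cons, List.mem_cons] at hd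
      rcases hd with rfl | hd
      · exact hab
      · exact hp d hd
  exact ⟨p.bypass, p.bypass_isPath, fun d hd => hp d (p.darts_bypass_subset_darts hd)⟩

theorem isChain_support_of_darts {T : SimpleGraph ι} {r : ι → ι → Prop} {u v : ι}
    (p : T.Walk u v) (hp : ∀ d ∈ p.darts, r d.fst d.snd) : p.support.IsChain r := by
  induction p with
  | nil => simp
  | cons h p ih =>
    simp only [SimpleGraph.Walk.darts_cons, List.mem_cons, forall_eq_or_imp] at hp
    have := ih hp.2
    rw [SimpleGraph.Walk.support_cons]
    rw [← SimpleGraph.Walk.cons_tail_support] at this ⊢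
    exact List.IsChain.cons_cons hp.1 this

theorem isDirectedPath_support {T : SimpleGraph ι} {G : Digraph ι} {u v : ι} {p : T.Walk u v}
    (hp : p.IsPath) (hd : ∀ d ∈ p.darts, G.Adj d.fst d.snd) :
    IsDirectedPath G u v p.support := by
  refine ⟨isChain_support_of_darts p hd, hp.support_nodup, ?_, ?_⟩
  · rw [← SimpleGraph.Walk.cons_tail_support, List.head?_cons]
  · rw [List.getLast?_eq_some_getLast p.support_ne_nil, SimpleGraph.Walk.getLast_support]

/-- An asymmetric relation inside a finite acyclic undirected graph has no directed cycle: the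
path closing a cycle through `u → v` is, by uniqueness of paths, the reverse edge `v → u`. -/
theorem wellFounded_of_isAcyclic [Finite ι] {T : SimpleGraph ι} (hT : T.IsAcyclic)
    {r : ι → ι → Prop} (hr : ∀ u v, r u v → T.Adj u v) (hasymm : ∀ u v, r u v → ¬ r v u) :
    WellFounded r := by
  have hirr : Std.Irrefl (Relation.TransGen r) := ⟨fun u hu => by
    obtain ⟨v, huv, hvu⟩ := Relation.TransGen.head'_iff.1 hu
    obtain ⟨p, hp, hd⟩ := exists_isPath_of_reflTransGen hr hvu
    have hadj : T.Adj v u := (hr _ _ huv).symm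
    have heq : p = hadj.toWalk :=
      congrArg Subtype.val
        ((hT.subsingleton_path v u).elim ⟨p, hp⟩ (SimpleGraph.Path.singleton hadj))
    subst heq
    exact hasymm _ _ huv (hd ⟨(v, u), hadj⟩ (by simp [SimpleGraph.Adj.toWalk]))⟩
  exact Subrelation.wf (fun h => Relation.TransGen.single h)
    (Finite.wellFounded_of_trans_of_irrefl (Relation.TransGen r))

end Graph

/-! ### Summing out attributes -/

section Marginalization

variable {ι : Type*} [Fintype ι] [DecidableEq ι] {Dom : ι → Type*}
  [∀ i, Fintype (Dom i)] [∀ i, DecidableEq (Dom i)]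

theorem sum_eq_sum_sum_update {M : Type*} [AddCommMonoid M] (F : (∀ i, Dom i) → M) (r : ι)
    (c : Dom r) :
    ∑ x, F x = ∑ x, if x r = c then ∑ a, F (Function.update x r a) else 0 := by
  rw [← Finset.sum_filter, ← Finset.sum_product']
  refine Finset.sum_bij' (fun x _ => (Function.update x r c, x r))
    (fun y _ => Function.update y.1 r y.2) ?_ ?_ ?_ ?_ ?_
  · simp
  · simp
  · simp
  · rintro ⟨x, a⟩ hx
    have hx : x r = c := by simpa using hx
    subst hx
    simp
  · simp

/-- In a sum over all tuples, a conditional distribution of the attribute `r` may be replaced by a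
point mass when the remaining factor `h` does not depend on `r`. -/
theorem sum_mul_eq_sum_mul_ite (h f : (∀ i, Dom i) → ℝ≥0∞) (r : ι) (c : Dom r)
    (hh : ∀ x a, h (Function.update x r a) = h x)
    (hf : ∀ x, ∑ a, f (Function.update x r a) = 1) :
    ∑ x, h x * f x = ∑ x, h x * if x r = c then 1 else 0 := by
  rw [sum_eq_sum_sum_update _ r c]
  refine Finset.sum_congr rfl fun x _ => ?_
  split_ifs
  · simp_rw [hh, ← Finset.mul_sum, hf]
  · simp

/-- Against a test function that ignores the child-closed set `R`, the tables of the attributes in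
`R` may be replaced by point masses at the arbitrary values `c`. -/
theorem sum_mul_joint_eq {G : Digraph ι} (hG : WellFounded G.Adj) (N : BayesNet Dom G)
    (φ : (∀ i, Dom i) → ℝ≥0∞) (c : ∀ i, Dom i) (R : Finset ι)
    (hR : ∀ u ∈ R, ∀ v, G.Adj u v → v ∈ R)
    (hφ : ∀ r ∈ R, ∀ x a, φ (Function.update x r a) = φ x) :
    ∑ x, φ x * N.joint x =
      ∑ x, φ x * ∏ j, if j ∈ R then (if x j = c j then 1 else 0)
        else N.cpt j (fun l => x l) (x j) := by
  induction R using Finset.strongInduction with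
  | H R ih =>
  rcases R.eq_empty_or_nonempty with rfl | hne
  · simp [BayesNet.joint]
  -- The sources of `R` are replaced last: without a source `r`, `R` is still closed under children,
  -- and once all other attributes of `R` carry point masses no other factor depends on `r`.
  obtain ⟨r, hrR, hmin⟩ := hG.has_min (R : Set ι) hne
  have hrR : r ∈ R := hrR
  rw [ih (R.erase r) (Finset.erase_ssubset hrR)
    (fun u hu v huv => Finset.mem_erase.2
      ⟨fun h => hmin u (Finset.mem_of_mem_erase hu) (h ▸ huv),
        hR u (Finset.mem_of_mem_erase hu) v huv⟩)
    (fun s hs => hφ s (Finset.mem_of_mem_erase hs))]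
  set g : (∀ i, Dom i) → ι → ℝ≥0∞ := fun x j =>
    if j ∈ R then (if x j = c j then 1 else 0) else N.cpt j (fun l => x l) (x j) with hg
  have hpar : ∀ (x : ∀ i, Dom i) (a : Dom r) (j : ι), ¬ G.Adj r j →
      (fun l : {l // G.Adj l j} => Function.update x r a l) =
        fun l : {l // G.Adj l j} => x l := by
    intro x a j hj
    funext l
    exact Function.update_of_ne (fun h : l.1 = r => hj (h ▸ l.2)) _ _
  have hgr : ∀ x a, ∀ j ∈ Finset.univ.erase r, g (Function.update x r a) j = g x j := by
    intro x a j hj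
    have hjr : j ≠ r := Finset.ne_of_mem_erase hj
    simp only [hg, Function.update_of_ne hjr]
    split_ifs with hjR
    · rfl
    · rfl
    · rw [hpar x a j fun h => hjR (hR r hrR j h)]
  calc _ = ∑ x, (φ x * ∏ j ∈ Finset.univ.erase r, g x j) * N.cpt r (fun l => x l) (x r) := by
        refine Finset.sum_congr rfl fun x _ => ?_
        rw [← Finset.mul_prod_erase _ _ (Finset.mem_univ r), mul_assoc,
          mul_comm (∏ j ∈ Finset.univ.erase r, g x j)]
        congr 2
        · simp
        · refine Finset.prod_congr rfl fun j hj => ?_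
          simp [hg, Finset.ne_of_mem_erase hj]
    _ = ∑ x, (φ x * ∏ j ∈ Finset.univ.erase r, g x j) * if x r = c r then 1 else 0 := by
        refine sum_mul_eq_sum_mul_ite _ _ r (c r) (fun x a => ?_) (fun x => ?_)
        · rw [hφ r hrR, Finset.prod_congr rfl (hgr x a)]
        · simp_rw [hpar x _ r (hmin r hrR), Function.update_self]
          rw [← tsum_fintype (L := .unconditional _), PMF.tsum_coe]
    _ = _ := by
        refine Finset.sum_congr rfl fun x _ => ?_
        rw [← Finset.mul_prod_erase _ (g x) (Finset.mem_univ r), mul_assoc,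
          mul_comm (∏ j ∈ Finset.univ.erase r, g x j)]
        simp [hg, hrR]

/-- In an acyclic Bayes net, the distribution of the attributes outside a child-closed set `R` is
determined by the tables outside `R`. -/
theorem prob_eq_of_cpt_eq {G : Digraph ι} (hG : WellFounded G.Adj) (N N' : BayesNet Dom G)
    (R O : Finset ι) (o : ∀ i, Dom i) (hR : ∀ u ∈ R, ∀ v, G.Adj u v → v ∈ R)
    (hRO : Disjoint R O) (hN : ∀ j ∉ R, N.cpt j = N'.cpt j) :
    N.prob O o = N'.prob O o := by
  have hφ : ∀ r ∈ R, ∀ (x : ∀ i, Dom i) (a : Dom r),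
      (if ∀ j ∈ O, Function.update x r a j = o j then 1 else 0 : ℝ≥0∞) =
        if ∀ j ∈ O, x j = o j then 1 else 0 := by
    intro r hr x a
    have : ∀ j ∈ O, Function.update x r a j = x j := fun j hj =>
      Function.update_of_ne (fun h : j = r => Finset.disjoint_left.1 hRO hr (h ▸ hj)) _ _
    congr 1
    exact propext (forall₂_congr fun j hj => by rw [this j hj])
  have hprob : ∀ M : BayesNet Dom G, M.prob O o =
      ∑ x, (if ∀ j ∈ O, x j = o j then 1 else 0) * M.joint x := fun M => by
    simp [BayesNet.prob]
  rw [hprob, hprob, sum_mul_joint_eq hG N _ o R hR hφ, sum_mul_joint_eq hG N' _ o R hR hφ]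
  refine Finset.sum_congr rfl fun x _ => congrArg _ (Finset.prod_congr rfl fun j _ => ?_)
  split_ifs with hj
  · rfl
  · rfl
  · rw [hN j hj]

end Marginalization

end FairMST

/-! ### Justifiable fairness -/

theorem proposition1 {ι : Type*} [Fintype ι] [DecidableEq ι] {Dom : ι → Type*}
    [∀ i, Fintype (Dom i)] [∀ i, DecidableEq (Dom i)]
    (D : Multiset (∀ i, Dom i)) (P A O : Finset ι)
    (hPA : Disjoint P A) (hPO : Disjoint P O) (hAO : Disjoint A O)
    (T : Digraph ι) (hT : FairMST.IsDirectedMarginalsMST D T)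
    (hpath : ∀ s ∈ P, ∀ t ∈ O, ∀ l : List ι, FairMST.IsDirectedPath T s t l → ∃ a ∈ l, a ∈ A)
    (N : FairMST.BayesNet Dom T) :
    N.IsJustifiablyFair P A O := by
  classical
  obtain ⟨S, ⟨-, hS⟩, hadj, hasymm⟩ := hT
  intro K hAK k o i hiP hiK p q
  set H := FairMST.cutIncoming T (insert i K)
  have hHS : ∀ u v, H.Adj u v → S.Adj u v := fun u v h => (hadj u v).2 (Or.inl h.1)
  have hwf : WellFounded H.Adj := FairMST.wellFounded_of_isAcyclic hS.isAcyclic hHS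
    fun u v h h' => hasymm u v h.1 h'.1
  refine FairMST.prob_eq_of_cpt_eq hwf _ _
    (Finset.univ.filter fun j => Relation.ReflTransGen H.Adj i j) O o ?_ ?_ ?_
  · intro u hu v huv
    simp only [Finset.mem_filter, Finset.mem_univ, true_and] at hu ⊢
    exact hu.tail huv
  · refine Finset.disjoint_left.2 fun t ht htO => ?_
    obtain ⟨w, hw, hd⟩ := FairMST.exists_isPath_of_reflTransGen hHS (Finset.mem_filter.1 ht).2
    obtain ⟨a, haw, haA⟩ := hpath i hiP t htO w.support
      (FairMST.isDirectedPath_support hw fun d hdw => (hd d hdw).1)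
    rw [← SimpleGraph.Walk.cons_tail_support, List.mem_cons] at haw
    rcases haw with rfl | haw
    · exact hiK (hAK haA)
    · rw [← SimpleGraph.Walk.map_snd_darts, List.mem_map] at haw
      obtain ⟨d, hdw, rfl⟩ := haw
      exact (hd d hdw).2 (Finset.mem_insert_of_mem (hAK haA))
  · intro j hj
    have hji : j ≠ i := by
      rintro rfl
      exact hj (Finset.mem_filter.2 ⟨Finset.mem_univ _, .refl⟩)
    simp [FairMST.BayesNet.intervene, Function.update_of_ne hji]
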